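/- Let $\varphi(s,r)$ be an arbitrary real-valued function of two real variables $s$ and $r$. Then for all $s,r$ with $r>0$ and $\varphi=\varphi(s,r)>r$, the two-step continued fraction $$T=\cfrac{4\cdot 1^2r^2}{1+\cfrac{4\cdot 1^2r^2}{\varphi^2-r^2+\cfrac{4\cdot 2^2r^2}{1+\cfrac{4\cdot 2^2r^2}{\varphi^2-r^2+\cdots}}}},$$ whose $(2n-1)$-st and $2n$-th partial numerators are both equal to $4n^2r^2$ $(n=1,2,\dots)$ and whose partial denominators are alternately $1$ and $\varphi^2-r^2$, converges to a real number $T$ with $\varphi^2-r^2+T\neq0$. Moreover, the integral below converges, and $$\frac{1}{\varphi^2-r^2+T}=\frac1{r^2}\int_0^\infty\frac{x\,e^{-x\varphi/r}}{\cosh x}\,dx .$$ -/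

import Mathlib

open Filter Topology MeasureTheory Set

/-- The two-step continued fraction
`h + a 1 / (b 1 + c 1 / (d 1 + a 2 / (b 2 + c 2 / (d 2 + ⋯))))`,
built from the sequences `(a n)`, `(b n)`, `(c n)`, `(d n)`, `n = 1, 2, …`.
The partial quotients are numbered `k = 0, 1, 2, …`; those with `k = 2 (n - 1)` are
`a n / b n` and those with `k = 2 (n - 1) + 1` are `c n / d n`. -/
noncomputable def twoStepContFract (h : ℝ) (a b c d : ℕ → ℝ) : GenContFract ℝ where
  h := h
  s := Stream'.Seq.ofStream fun k =>
    if Even k then ⟨a (k / 2 + 1), b (k / 2 + 1)⟩ else ⟨c (k / 2 + 1), d (k / 2 + 1)⟩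

/-- The continued fraction `g` converges and has the value `v`: only finitely many of the
denominators of its convergents vanish, and the convergents tend to `v`. -/
def ContFractHasValue (g : GenContFract ℝ) (v : ℝ) : Prop :=
  (∀ᶠ n in atTop, g.dens n ≠ 0) ∧ Tendsto (fun n => g.convs n) atTop (𝓝 v)

/-! Put `p = φ/r > 1`, let `W n` be `sechMoment n`, so that `W 0 = x / cosh x`, and let `u n` be its
Laplace transform at `p`. The `W n` satisfy a second-order differential equation with constant
coefficients linking three consecutive indices (`hasDerivAt_sechMomentDeriv_succ`). Its Laplace
transform is `(p² - 1) u n + 4 (n+1)² (u n - u (n+1)) = 4 n² (u (n-1) - u n)`, with right side `1`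
when `n = 0`. Hence `u n` and `u n - u (n+1)`, interleaved and rescaled, solve the tail recurrence
of the continued fraction, and they are positive because `0 < W (n+1) < W n` on `x > 0`.

A positive tail solution bounds the error of the convergents by the products of partial numerators
over products of consecutive denominators (`tendsto_div_of_pos_tail`); that bound tends to zero by
`tendsto_den_growth`. The equation at `n = 0` then gives `φ² - r² + T = r² / u 0`. -/

/-! ### Hyperbolic moments: recurrence, positivity, comparison -/

/-- The functions `∫₀ˣ (sinh² x - sinh² y)ⁿ dy`, defined through their derivatives. -/
noncomputable def sinhMoment : ℕ → ℝ → ℝ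
  | 0 => fun x => x
  | n + 1 => fun x => (n + 1 : ℝ) * ∫ t in (0 : ℝ)..x, Real.sinh (2 * t) * sinhMoment n t

theorem sinhMoment_zero_apply (x : ℝ) : sinhMoment 0 x = x := rfl

theorem continuous_sinhMoment (n : ℕ) : Continuous (sinhMoment n) := by
  induction n with
  | zero => exact continuous_id
  | succ n ih =>
    refine continuous_const.mul (intervalIntegral.continuous_primitive (fun a b => ?_) 0)
    apply Continuous.intervalIntegrable
    fun_prop

theorem hasDerivAt_sinhMoment_zero (x : ℝ) : HasDerivAt (sinhMoment 0) 1 x := hasDerivAt_id x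

theorem hasDerivAt_sinhMoment_succ (n : ℕ) (x : ℝ) :
    HasDerivAt (sinhMoment (n + 1)) ((n + 1) * (Real.sinh (2 * x) * sinhMoment n x)) x := by
  have hc : Continuous fun t : ℝ => Real.sinh (2 * t) * sinhMoment n t := by
    have := continuous_sinhMoment n
    fun_prop
  exact (hc.integral_hasStrictDerivAt 0 x).hasDerivAt.const_mul (n + 1 : ℝ)

theorem sinhMoment_apply_zero (n : ℕ) : sinhMoment n 0 = 0 := by
  cases n <;> simp [sinhMoment]

theorem hasDerivAt_sinh_two_mul (x : ℝ) :
    HasDerivAt (fun x : ℝ => Real.sinh (2 * x)) (2 * Real.cosh (2 * x)) x := by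
  have := ((hasDerivAt_id x).const_mul (2 : ℝ)).sinh
  simpa [mul_comm] using this

theorem hasDerivAt_cosh_two_mul (x : ℝ) :
    HasDerivAt (fun x : ℝ => Real.cosh (2 * x)) (2 * Real.sinh (2 * x)) x := by
  have := ((hasDerivAt_id x).const_mul (2 : ℝ)).cosh
  simpa [mul_comm] using this

theorem eq_of_hasDerivAt_eq {f g f' : ℝ → ℝ} (hf : ∀ x, HasDerivAt f (f' x) x)
    (hg : ∀ x, HasDerivAt g (f' x) x) (h0 : f 0 = g 0) (x : ℝ) : f x = g x := by
  have h := is_const_of_deriv_eq_zero (f := fun x => f x - g x)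
    (fun y => ((hf y).sub (hg y)).differentiableAt)
    (fun y => (((hf y).sub (hg y)).congr_deriv (sub_self _)).deriv) x 0
  simp only [h0, sub_self] at h
  linarith

theorem sinhMoment_one (x : ℝ) :
    4 * sinhMoment 1 x = 2 * (Real.cosh (2 * x) * sinhMoment 0 x) - Real.sinh (2 * x) := by
  refine eq_of_hasDerivAt_eq
      (f := fun x => 4 * sinhMoment 1 x)
    (g := fun x => 2 * (Real.cosh (2 * x) * sinhMoment 0 x) - Real.sinh (2 * x))
    (fun x => (hasDerivAt_sinhMoment_succ 0 x).const_mul 4) (fun x => ?_)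
    (by simp [sinhMoment_apply_zero]) x
  refine HasDerivAt.congr_deriv
    ((((hasDerivAt_cosh_two_mul x).mul (hasDerivAt_sinhMoment_zero x)).const_mul 2).sub
    (hasDerivAt_sinh_two_mul x)) ?_
  push_cast
  ring

/-- Both sides vanish at `0`, and their derivatives agree by a multiple of the same relation one
index lower. -/
theorem sinhMoment_add_two (n : ℕ) (x : ℝ) :
    4 * (n + 2) * sinhMoment (n + 2) x =
      (4 * n + 6) * (Real.cosh (2 * x) * sinhMoment (n + 1) x) -
        (n + 1) * (Real.sinh (2 * x) ^ 2 * sinhMoment n x) := by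
  induction n generalizing x with
  | zero =>
    refine eq_of_hasDerivAt_eq
      (f := fun x => 4 * (((0 : ℕ) : ℝ) + 2) * sinhMoment (0 + 2) x)
      (g := fun x => (4 * ((0 : ℕ) : ℝ) + 6) * (Real.cosh (2 * x) * sinhMoment (0 + 1) x) -
        (((0 : ℕ) : ℝ) + 1) * (Real.sinh (2 * x) ^ 2 * sinhMoment 0 x))
      (fun x => (hasDerivAt_sinhMoment_succ 1 x).const_mul _) (fun x => ?_)
      (by simp [sinhMoment_apply_zero]) x
    refine HasDerivAt.congr_deriv
      ((((hasDerivAt_cosh_two_mul x).mul (hasDerivAt_sinhMoment_succ 0 x)).const_mul _).sub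
      ((((hasDerivAt_sinh_two_mul x).pow 2).mul (hasDerivAt_sinhMoment_zero x)).const_mul _)) ?_
    push_cast
    simp only [Pi.pow_apply]
    linear_combination -Real.sinh (2 * x) * sinhMoment_one x
  | succ n ih =>
    refine eq_of_hasDerivAt_eq
      (f := fun x => 4 * (((n + 1 : ℕ) : ℝ) + 2) * sinhMoment ((n + 1) + 2) x)
      (g := fun x =>
        (4 * ((n + 1 : ℕ) : ℝ) + 6) * (Real.cosh (2 * x) * sinhMoment ((n + 1) + 1) x) -
        (((n + 1 : ℕ) : ℝ) + 1) * (Real.sinh (2 * x) ^ 2 * sinhMoment (n + 1) x))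
      (fun x => (hasDerivAt_sinhMoment_succ (n + 2) x).const_mul _)
      (fun x => ?_) (by simp [sinhMoment_apply_zero]) x
    refine HasDerivAt.congr_deriv ((((hasDerivAt_cosh_two_mul x).mul
      (hasDerivAt_sinhMoment_succ (n + 1) x)).const_mul _).sub
      ((((hasDerivAt_sinh_two_mul x).pow 2).mul (hasDerivAt_sinhMoment_succ n x)).const_mul _)) ?_
    push_cast
    simp only [Pi.pow_apply]
    linear_combination -(n + 2) * Real.sinh (2 * x) * ih x

theorem sinhMoment_nonneg (n : ℕ) {x : ℝ} (hx : 0 ≤ x) : 0 ≤ sinhMoment n x := by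
  induction n generalizing x with
  | zero => exact hx
  | succ n ih =>
    refine mul_nonneg (by positivity) (intervalIntegral.integral_nonneg hx fun t ht => ?_)
    exact mul_nonneg (Real.sinh_nonneg_iff.2 (by linarith [ht.1])) (ih ht.1)

theorem sinhMoment_pos (n : ℕ) {x : ℝ} (hx : 0 < x) : 0 < sinhMoment n x := by
  induction n generalizing x with
  | zero => exact hx
  | succ n ih =>
    refine mul_pos (by positivity) (intervalIntegral.intervalIntegral_pos_of_pos_on ?_ ?_ hx)
    · have := continuous_sinhMoment n
      apply Continuous.intervalIntegrable
      fun_prop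
    · intro t ht
      exact mul_pos (Real.sinh_pos_iff.2 (by linarith [ht.1])) (ih ht.1)

/-- In integral form this is `sinh² x - sinh² y ≤ sinh² x`. From the recursive definition, the
difference of the two sides is monotone, its derivative being nonnegative by the inequality one
index lower. -/
theorem sinhMoment_succ_le (n : ℕ) {x : ℝ} (hx : 0 ≤ x) :
    sinhMoment (n + 1) x ≤ Real.sinh x ^ 2 * sinhMoment n x := by
  have key : ∀ (d : ℝ → ℝ), (∀ y, HasDerivAt (sinhMoment n) (d y) y) →
      (∀ y, 0 ≤ y → n * (Real.sinh (2 * y) * sinhMoment n y) ≤ Real.sinh y ^ 2 * d y) →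
      sinhMoment (n + 1) x ≤ Real.sinh x ^ 2 * sinhMoment n x := by
    intro d hd hle
    have hder : ∀ y, HasDerivAt
        (fun y => Real.sinh y ^ 2 * sinhMoment n y - sinhMoment (n + 1) y) _ y := fun y =>
      (((Real.hasDerivAt_sinh y).pow 2).mul (hd y)).sub (hasDerivAt_sinhMoment_succ n y)
    have hmono : MonotoneOn
        (fun y => Real.sinh y ^ 2 * sinhMoment n y - sinhMoment (n + 1) y) (Ici 0) := by
      refine monotoneOn_of_deriv_nonneg (convex_Ici 0)
        (fun y _ => (hder y).continuousAt.continuousWithinAt)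
        (fun y _ => (hder y).differentiableAt.differentiableWithinAt) fun y hy => ?_
      rw [interior_Ici] at hy
      rw [(hder y).deriv]
      have h1 := hle y hy.le
      have h2 := Real.sinh_two_mul y
      simp only [Pi.pow_apply]
      push_cast
      rw [h2] at h1 ⊢
      linarith
    have := hmono self_mem_Ici hx hx
    simp only [sinhMoment_apply_zero] at this
    linarith
  cases n with
  | zero =>
    refine key _ hasDerivAt_sinhMoment_zero fun y _ => ?_
    simp only [Nat.cast_zero, zero_mul]
    positivity
  | succ n =>
    refine key _ (hasDerivAt_sinhMoment_succ n) fun y hy => ?_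
    have ih := sinhMoment_succ_le n hy
    have hs : 0 ≤ Real.sinh (2 * y) := Real.sinh_nonneg_iff.2 (by linarith)
    push_cast
    calc (n + 1 : ℝ) * (Real.sinh (2 * y) * sinhMoment (n + 1) y)
        ≤ (n + 1 : ℝ) * (Real.sinh (2 * y) * (Real.sinh y ^ 2 * sinhMoment n y)) := by gcongr
      _ = _ := by ring

/-! ### Normalized moments and their differential equation -/

/-- The functions `(cosh x)⁻²ⁿ⁻¹ ∫₀ˣ (sinh² x - sinh² y)ⁿ dy`. -/
noncomputable def sechMoment (n : ℕ) (x : ℝ) : ℝ := sinhMoment n x / Real.cosh x ^ (2 * n + 1)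

/-- The derivative of `sechMoment n`. -/
noncomputable def sechMomentDeriv : ℕ → ℝ → ℝ
  | 0 => fun x => 1 / Real.cosh x - Real.sinh x / Real.cosh x * sechMoment 0 x
  | n + 1 => fun x => Real.sinh x / Real.cosh x *
      (2 * (n + 1) * sechMoment n x - (2 * n + 3) * sechMoment (n + 1) x)

theorem hasDerivAt_sechMoment (n : ℕ) (x : ℝ) :
    HasDerivAt (sechMoment n) (sechMomentDeriv n x) x := by
  have hc := (Real.cosh_pos x).ne'
  cases n with
  | zero =>
    refine HasDerivAt.congr_deriv
      ((hasDerivAt_sinhMoment_zero x).div ((Real.hasDerivAt_cosh x).pow (2 * 0 + 1))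
      (pow_ne_zero _ hc)) ?_
    simp only [sechMomentDeriv, sechMoment]
    field_simp
    simp
    ring
  | succ n =>
    refine HasDerivAt.congr_deriv
      ((hasDerivAt_sinhMoment_succ n x).div ((Real.hasDerivAt_cosh x).pow (2 * (n + 1) + 1))
      (pow_ne_zero _ hc)) ?_
    simp only [sechMomentDeriv, sechMoment, Real.sinh_two_mul]
    push_cast
    rw [show 2 * (n + 1) + 1 = 2 * n + 1 + 2 by ring, show 2 * (n + 1) = 2 * n + 1 + 1 by ring]
    simp only [pow_add _ (2 * n + 1)]
    field_simp
    ring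

/-- The three-term relation removes `tanh` from the right side. Every term of the second derivative
can be reduced to such products, so its coefficients become constant. -/
theorem tanh_mul_sechMomentDeriv (n : ℕ) (x : ℝ) :
    Real.sinh x / Real.cosh x * sechMomentDeriv n x =
      (2 * n + 1) * sechMoment n x - 2 * (n + 1) * sechMoment (n + 1) x := by
  have hc := (Real.cosh_pos x).ne'
  have hs := Real.sinh_sq x
  cases n with
  | zero =>
    have h := sinhMoment_one x
    rw [Real.sinh_two_mul, Real.cosh_two_mul, hs] at h
    simp only [sechMomentDeriv, sechMoment]
    push_cast
    field_simp
    linear_combination (1 / 2) * h - sinhMoment 0 x * hs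
  | succ n =>
    have h := sinhMoment_add_two n x
    rw [Real.sinh_two_mul, Real.cosh_two_mul, mul_pow, mul_pow, hs] at h
    simp only [sechMomentDeriv, sechMoment]
    push_cast
    rw [show 2 * (n + 1 + 1) + 1 = 2 * n + 1 + 4 by ring,
      show 2 * (n + 1) + 1 = 2 * n + 1 + 2 by ring]
    simp only [pow_add _ (2 * n + 1)]
    field_simp
    rw [hs]
    linear_combination (1 / 2) * h

theorem hasDerivAt_sinh_div_cosh (x : ℝ) :
    HasDerivAt (fun x : ℝ => Real.sinh x / Real.cosh x)
      (1 - (Real.sinh x / Real.cosh x) ^ 2) x := by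
  have hc := (Real.cosh_pos x).ne'
  refine HasDerivAt.congr_deriv ((Real.hasDerivAt_sinh x).div (Real.hasDerivAt_cosh x) hc) ?_
  field_simp

theorem hasDerivAt_sechMomentDeriv_zero (x : ℝ) :
    HasDerivAt (sechMomentDeriv 0)
      (sechMoment 0 x - 4 * (sechMoment 0 x - sechMoment 1 x)) x := by
  have hc := (Real.cosh_pos x).ne'
  have h0 := tanh_mul_sechMomentDeriv 0 x
  refine HasDerivAt.congr_deriv (((hasDerivAt_const x (1 : ℝ)).div (Real.hasDerivAt_cosh x) hc).sub
    ((hasDerivAt_sinh_div_cosh x).mul (hasDerivAt_sechMoment 0 x))) ?_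
  have h1 : sechMomentDeriv 0 x =
    1 / Real.cosh x - Real.sinh x / Real.cosh x * sechMoment 0 x := rfl
  have h2 : (0 * Real.cosh x - 1 * Real.sinh x) / Real.cosh x ^ 2 =
      - (Real.sinh x / Real.cosh x * (1 / Real.cosh x)) := by
    field_simp
    ring
  rw [h2]
  push_cast at h0
  linear_combination -2 * h0 + Real.sinh x / Real.cosh x * h1

theorem hasDerivAt_sechMomentDeriv_succ (n : ℕ) (x : ℝ) :
    HasDerivAt (sechMomentDeriv (n + 1))
      (sechMoment (n + 1) x + 4 * (n + 1) ^ 2 * (sechMoment n x - sechMoment (n + 1) x) -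
        4 * (n + 2) ^ 2 * (sechMoment (n + 1) x - sechMoment (n + 2) x)) x := by
  have h0 := tanh_mul_sechMomentDeriv n x
  have h1 := tanh_mul_sechMomentDeriv (n + 1) x
  refine HasDerivAt.congr_deriv ((hasDerivAt_sinh_div_cosh x).mul
    (((hasDerivAt_sechMoment n x).const_mul (2 * (n + 1) : ℝ)).sub
      ((hasDerivAt_sechMoment (n + 1) x).const_mul (2 * n + 3 : ℝ)))) ?_
  have h2 : sechMomentDeriv (n + 1) x = Real.sinh x / Real.cosh x *
      (2 * (n + 1) * sechMoment n x - (2 * n + 3) * sechMoment (n + 1) x) := rfl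
  push_cast at h1
  linear_combination 2 * (n + 1) * h0 - (2 * n + 4) * h1 + Real.sinh x / Real.cosh x * h2

theorem sechMoment_apply_zero (n : ℕ) : sechMoment n 0 = 0 := by
  simp [sechMoment, sinhMoment_apply_zero]

theorem sechMomentDeriv_zero_apply_zero : sechMomentDeriv 0 0 = 1 := by
  simp [sechMomentDeriv]

theorem sechMomentDeriv_succ_apply_zero (n : ℕ) : sechMomentDeriv (n + 1) 0 = 0 := by
  simp [sechMomentDeriv]

theorem continuous_sechMoment (n : ℕ) : Continuous (sechMoment n) :=
  continuous_iff_continuousAt.2 fun x => (hasDerivAt_sechMoment n x).continuousAt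

theorem sechMoment_pos (n : ℕ) {x : ℝ} (hx : 0 < x) : 0 < sechMoment n x :=
  div_pos (sinhMoment_pos n hx) (pow_pos (Real.cosh_pos x) _)

theorem sechMoment_nonneg (n : ℕ) {x : ℝ} (hx : 0 ≤ x) : 0 ≤ sechMoment n x :=
  div_nonneg (sinhMoment_nonneg n hx) (pow_pos (Real.cosh_pos x) _).le

/-- The ratio of consecutive terms is at most `tanh² x < 1`. This strictness makes the odd-indexed
tails positive. -/
theorem sechMoment_succ_lt (n : ℕ) {x : ℝ} (hx : 0 < x) :
    sechMoment (n + 1) x < sechMoment n x := by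
  have hc := Real.cosh_pos x
  have h := sinhMoment_succ_le n hx.le
  have hp := sinhMoment_pos n hx
  rw [Real.sinh_sq] at h
  rw [sechMoment, sechMoment, show 2 * (n + 1) + 1 = 2 + (2 * n + 1) by ring, pow_add, ← div_div,
    div_lt_div_iff_of_pos_right (by positivity), div_lt_iff₀ (by positivity)]
  linarith

theorem sechMoment_le_self (n : ℕ) {x : ℝ} (hx : 0 < x) : sechMoment n x ≤ x := by
  induction n with
  | zero =>
    simp only [sechMoment, sinhMoment, mul_zero, zero_add, pow_one]
    exact div_le_self hx.le (Real.one_le_cosh x)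
  | succ n ih => exact (sechMoment_succ_lt n hx).le.trans ih

theorem abs_sechMomentDeriv_le (n : ℕ) {x : ℝ} (hx : 0 < x) :
    |sechMomentDeriv n x| ≤ (4 * n + 1) * x + 1 := by
  have hc := Real.cosh_pos x
  have ht0 : 0 ≤ Real.sinh x / Real.cosh x := div_nonneg (Real.sinh_nonneg_iff.2 hx.le) hc.le
  have ht1 : Real.sinh x / Real.cosh x ≤ 1 := (div_le_one hc).2 (Real.sinh_lt_cosh x).le
  cases n with
  | zero =>
    have h0 := sechMoment_nonneg 0 hx.le
    have h1 := sechMoment_le_self 0 hx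
    have h2 : 0 < 1 / Real.cosh x := by positivity
    have h3 : 1 / Real.cosh x ≤ 1 := (div_le_one hc).2 (Real.one_le_cosh x)
    have h4 := mul_nonneg ht0 h0
    have h5 := mul_le_mul ht1 h1 h0 zero_le_one
    simp only [sechMomentDeriv]
    rw [abs_le]
    constructor <;> push_cast <;> linarith
  | succ n =>
    have h0 := sechMoment_nonneg n hx.le
    have h1 := sechMoment_le_self n hx
    have h0' := sechMoment_nonneg (n + 1) hx.le
    have h1' := sechMoment_le_self (n + 1) hx
    have hn : (0 : ℝ) ≤ n := n.cast_nonneg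
    simp only [sechMomentDeriv]
    rw [abs_mul, abs_of_nonneg ht0]
    have : |2 * (n + 1) * sechMoment n x - (2 * n + 3) * sechMoment (n + 1) x| ≤
        (4 * n + 5) * x := by
      rw [abs_le]
      constructor <;> nlinarith
    push_cast
    nlinarith [abs_nonneg (2 * (n + 1) * sechMoment n x - (2 * n + 3) * sechMoment (n + 1) x)]

/-! ### Laplace transforms -/

theorem integrableOn_exp_neg_mul_mul_self {p : ℝ} (hp : 0 < p) :
    IntegrableOn (fun x : ℝ => Real.exp (-p * x) * x) (Ioi 0) := by
  refine (integrableOn_rpow_mul_exp_neg_mul_rpow (s := 1) (p := 1) (by norm_num) one_pos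
    hp).congr_fun (fun x _ => ?_) measurableSet_Ioi
  simp [mul_comm]

theorem integrableOn_exp_neg_mul_sechMoment {p : ℝ} (hp : 0 < p) (n : ℕ) :
    IntegrableOn (fun x : ℝ => Real.exp (-p * x) * sechMoment n x) (Ioi 0) := by
  refine (integrableOn_exp_neg_mul_mul_self hp).mono' ?_ ?_
  · have := continuous_sechMoment n
    exact Continuous.aestronglyMeasurable (by fun_prop)
  · refine (ae_restrict_iff' measurableSet_Ioi).2 (ae_of_all _ fun x hx => ?_)
    rw [Real.norm_eq_abs, abs_of_nonneg (mul_nonneg (Real.exp_pos _).le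
      (sechMoment_nonneg n (le_of_lt hx)))]
    exact mul_le_mul_of_nonneg_left (sechMoment_le_self n hx) (Real.exp_pos _).le

theorem tendsto_exp_neg_mul_sechMoment {p : ℝ} (hp : 0 < p) (n : ℕ) :
    Tendsto (fun x => Real.exp (-p * x) * (sechMomentDeriv n x + p * sechMoment n x)) atTop
      (𝓝 0) := by
  have h1 : Tendsto (fun x : ℝ => x * Real.exp (-p * x)) atTop (𝓝 0) := by
    simpa using tendsto_rpow_mul_exp_neg_mul_atTop_nhds_zero 1 p hp
  have h2 : Tendsto (fun x : ℝ => Real.exp (-p * x)) atTop (𝓝 0) := by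
    simpa using tendsto_rpow_mul_exp_neg_mul_atTop_nhds_zero 0 p hp
  have h3 : Tendsto (fun x : ℝ => (4 * n + 1 + p) * (x * Real.exp (-p * x)) + Real.exp (-p * x))
      atTop (𝓝 0) := by
    simpa using (h1.const_mul (4 * n + 1 + p)).add h2
  refine squeeze_zero_norm' ?_ h3
  filter_upwards [eventually_gt_atTop 0] with x hx
  have hd := abs_sechMomentDeriv_le n hx
  have hW : |p * sechMoment n x| ≤ p * x := by
    rw [abs_of_nonneg (mul_nonneg hp.le (sechMoment_nonneg n hx.le))]
    exact mul_le_mul_of_nonneg_left (sechMoment_le_self n hx) hp.le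
  rw [Real.norm_eq_abs, abs_mul, abs_of_pos (Real.exp_pos _)]
  calc _ ≤ Real.exp (-p * x) * ((4 * n + 1) * x + 1 + p * x) :=
        mul_le_mul_of_nonneg_left ((abs_add_le _ _).trans (add_le_add hd hW)) (Real.exp_pos _).le
    _ = _ := by ring

/-- The Laplace transform of `sechMoment n`. -/
noncomputable def laplaceSechMoment (p : ℝ) (n : ℕ) : ℝ :=
  ∫ x in Ioi (0 : ℝ), Real.exp (-p * x) * sechMoment n x

/-- Two integrations by parts at once: `e^{-px} (W' + p W)` is a primitive of `e^{-px} (W'' - p²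
W)`. The boundary term at `0` is nonzero only for `n = 0`, which is the source of the `1` in
`laplaceSechMoment_zero`. -/
theorem laplace_secondDeriv {p : ℝ} (hp : 0 < p) (n : ℕ) {w : ℝ → ℝ}
    (hw : ∀ x, HasDerivAt (sechMomentDeriv n) (w x) x)
    (hint : IntegrableOn (fun x : ℝ => Real.exp (-p * x) * w x) (Ioi 0)) :
    ∫ x in Ioi (0 : ℝ), Real.exp (-p * x) * w x =
      p ^ 2 * laplaceSechMoment p n - sechMomentDeriv n 0 := by
  have hW := integrableOn_exp_neg_mul_sechMoment hp n
  have hder : ∀ x, HasDerivAt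
      (fun x => Real.exp (-p * x) * (sechMomentDeriv n x + p * sechMoment n x))
      (Real.exp (-p * x) * w x - p ^ 2 * (Real.exp (-p * x) * sechMoment n x)) x := fun x => by
    refine HasDerivAt.congr_deriv ((((hasDerivAt_id x).const_mul (-p)).exp).mul
      ((hw x).add ((hasDerivAt_sechMoment n x).const_mul p))) ?_
    simp only [id]
    ring
  have h := integral_Ioi_of_hasDerivAt_of_tendsto' (a := 0) (fun x _ => hder x)
    (hint.sub (hW.const_mul (p ^ 2))) (tendsto_exp_neg_mul_sechMoment hp n)
  rw [integral_sub hint (hW.const_mul (p ^ 2)), integral_const_mul, sechMoment_apply_zero] at h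
  simp only [mul_zero, Real.exp_zero, add_zero, one_mul, zero_sub] at h
  rw [laplaceSechMoment]
  linarith

theorem laplaceSechMoment_zero {p : ℝ} (hp : 0 < p) :
    (p ^ 2 - 1) * laplaceSechMoment p 0 +
      4 * (laplaceSechMoment p 0 - laplaceSechMoment p 1) = 1 := by
  have h0 := integrableOn_exp_neg_mul_sechMoment hp 0
  have h1 := integrableOn_exp_neg_mul_sechMoment hp 1
  have e : (fun x : ℝ => Real.exp (-p * x) *
      (sechMoment 0 x - 4 * (sechMoment 0 x - sechMoment 1 x))) = fun x =>
      -3 * (Real.exp (-p * x) * sechMoment 0 x) + 4 * (Real.exp (-p * x) * sechMoment 1 x) := by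
    ext x
    ring
  have h := laplace_secondDeriv hp 0 hasDerivAt_sechMomentDeriv_zero
    (e ▸ (h0.const_mul (-3)).add (h1.const_mul 4))
  rw [e, integral_add (h0.const_mul (-3)) (h1.const_mul 4), integral_const_mul, integral_const_mul,
    sechMomentDeriv_zero_apply_zero] at h
  simp only [laplaceSechMoment] at h ⊢
  linarith

theorem laplaceSechMoment_succ {p : ℝ} (hp : 0 < p) (n : ℕ) :
    (p ^ 2 - 1) * laplaceSechMoment p (n + 1) +
        4 * (n + 2) ^ 2 * (laplaceSechMoment p (n + 1) - laplaceSechMoment p (n + 2)) =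
      4 * (n + 1) ^ 2 * (laplaceSechMoment p n - laplaceSechMoment p (n + 1)) := by
  have h0 := (integrableOn_exp_neg_mul_sechMoment hp n).const_mul (4 * (n + 1) ^ 2 : ℝ)
  have h1 := (integrableOn_exp_neg_mul_sechMoment hp (n + 1)).const_mul
    (1 - 4 * (n + 1) ^ 2 - 4 * (n + 2) ^ 2 : ℝ)
  have h2 := (integrableOn_exp_neg_mul_sechMoment hp (n + 2)).const_mul (4 * (n + 2) ^ 2 : ℝ)
  have h12 : IntegrableOn (fun x : ℝ =>
      (1 - 4 * (n + 1) ^ 2 - 4 * (n + 2) ^ 2) * (Real.exp (-p * x) * sechMoment (n + 1) x) +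
        4 * (n + 2) ^ 2 * (Real.exp (-p * x) * sechMoment (n + 2) x)) (Ioi 0) := h1.add h2
  have e : (fun x : ℝ => Real.exp (-p * x) *
      (sechMoment (n + 1) x + 4 * (n + 1) ^ 2 * (sechMoment n x - sechMoment (n + 1) x) -
        4 * (n + 2) ^ 2 * (sechMoment (n + 1) x - sechMoment (n + 2) x))) = fun x =>
      4 * (n + 1) ^ 2 * (Real.exp (-p * x) * sechMoment n x) +
      ((1 - 4 * (n + 1) ^ 2 - 4 * (n + 2) ^ 2) * (Real.exp (-p * x) * sechMoment (n + 1) x) +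
        4 * (n + 2) ^ 2 * (Real.exp (-p * x) * sechMoment (n + 2) x)) := by
    ext x
    ring
  have h := laplace_secondDeriv hp (n + 1) (hasDerivAt_sechMomentDeriv_succ n)
    (e ▸ h0.add h12)
  rw [e, integral_add h0 h12, integral_add h1 h2, integral_const_mul, integral_const_mul,
    integral_const_mul, sechMomentDeriv_succ_apply_zero] at h
  simp only [laplaceSechMoment] at h ⊢
  linarith

theorem setIntegral_Ioi_pos {f : ℝ → ℝ} {a : ℝ} (hf : IntegrableOn f (Ioi a))
    (hpos : ∀ x ∈ Ioi a, 0 < f x) : 0 < ∫ x in Ioi a, f x := by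
  rw [setIntegral_pos_iff_support_of_nonneg_ae ((ae_restrict_iff' measurableSet_Ioi).2
    (ae_of_all _ fun x hx => (hpos x hx).le)) hf]
  have : Function.support f ∩ Ioi a = Ioi a :=
    inter_eq_right.2 fun x hx => (hpos x hx).ne'
  simp [this]

theorem laplaceSechMoment_pos {p : ℝ} (hp : 0 < p) (n : ℕ) : 0 < laplaceSechMoment p n :=
  setIntegral_Ioi_pos (integrableOn_exp_neg_mul_sechMoment hp n) fun _ hx =>
    mul_pos (Real.exp_pos _) (sechMoment_pos n hx)

theorem laplaceSechMoment_succ_lt {p : ℝ} (hp : 0 < p) (n : ℕ) :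
    laplaceSechMoment p (n + 1) < laplaceSechMoment p n := by
  have h0 := integrableOn_exp_neg_mul_sechMoment hp n
  have h1 := integrableOn_exp_neg_mul_sechMoment hp (n + 1)
  have h := setIntegral_Ioi_pos (h0.sub h1) fun x hx =>
    sub_pos.2 (mul_lt_mul_of_pos_left (sechMoment_succ_lt n hx) (Real.exp_pos _))
  simp only [Pi.sub_apply] at h
  rw [integral_sub h0 h1] at h
  exact sub_pos.1 h

/-! ### Convergence from a positive solution of the tail recurrence -/

section Recurrence

variable {a b A B Y : ℕ → ℝ}

theorem tail_den_identity (hB0 : B 0 = 1) (hB1 : B 1 = b 0)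
    (hB : ∀ k, B (k + 2) = b (k + 1) * B (k + 1) + a (k + 1) * B k)
    (hY : ∀ k, Y k = b k * Y (k + 1) + a (k + 1) * Y (k + 2)) (k : ℕ) :
    B (k + 1) * Y (k + 1) + a (k + 1) * B k * Y (k + 2) = Y 0 := by
  induction k with
  | zero => rw [hB0, hB1, hY 0]; ring
  | succ k ih => rw [← ih, hB, hY (k + 1)]; ring

/-- Both sides, as sequences in `k`, satisfy the recurrence of `A` and `B` with the same two initial
values. -/
theorem tail_error_identity (hA0 : A 0 = 0) (hA1 : A 1 = a 0)
    (hA : ∀ k, A (k + 2) = b (k + 1) * A (k + 1) + a (k + 1) * A k)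
    (hB0 : B 0 = 1) (hB1 : B 1 = b 0)
    (hB : ∀ k, B (k + 2) = b (k + 1) * B (k + 1) + a (k + 1) * B k)
    (hY : ∀ k, Y k = b k * Y (k + 1) + a (k + 1) * Y (k + 2)) (k : ℕ) :
    Y 0 * A k - a 0 * Y 1 * B k =
      (-1) ^ (k + 1) * (∏ i ∈ Finset.range (k + 1), a i) * Y (k + 1) := by
  induction k using Nat.twoStepInduction with
  | zero => rw [hA0, hB0]; simp
  | one => rw [hA1, hB1, hY 0]; simp [Finset.prod_range_succ]; ring
  | more k h0 h1 =>
    rw [hA, hB]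
    simp only [Finset.prod_range_succ _ (k + 1), Finset.prod_range_succ _ (k + 1 + 1)] at h1 ⊢
    rw [hY (k + 1)] at h0
    linear_combination b (k + 1) * h1 + a (k + 1) * h0

theorem den_pos (ha : ∀ k, 0 < a k) (hb : ∀ k, 0 < b k) (hB0 : B 0 = 1) (hB1 : B 1 = b 0)
    (hB : ∀ k, B (k + 2) = b (k + 1) * B (k + 1) + a (k + 1) * B k) (k : ℕ) : 0 < B k := by
  induction k using Nat.twoStepInduction with
  | zero => rw [hB0]; exact one_pos
  | one => rw [hB1]; exact hb 0
  | more k h0 h1 =>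
    rw [hB]
    exact add_pos (mul_pos (hb _) h1) (mul_pos (ha _) h0)

/-- A continued fraction with positive elements has the value given by a positive solution `Y` of
the recurrence for its tails, as soon as the products of consecutive denominators outgrow the
products of the partial numerators. -/
theorem tendsto_div_of_pos_tail (ha : ∀ k, 0 < a k) (hb : ∀ k, 0 < b k)
    (hA0 : A 0 = 0) (hA1 : A 1 = a 0)
    (hA : ∀ k, A (k + 2) = b (k + 1) * A (k + 1) + a (k + 1) * A k)
    (hB0 : B 0 = 1) (hB1 : B 1 = b 0)
    (hB : ∀ k, B (k + 2) = b (k + 1) * B (k + 1) + a (k + 1) * B k)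
    (hY : ∀ k, Y k = b k * Y (k + 1) + a (k + 1) * Y (k + 2)) (hYpos : ∀ k, 0 < Y k)
    (hlim : Tendsto (fun k => B k * B (k + 1) / ∏ i ∈ Finset.range (k + 1), a i) atTop atTop) :
    Tendsto (fun k => A k / B k) atTop (𝓝 (a 0 * Y 1 / Y 0)) := by
  have hBpos := den_pos ha hb hB0 hB1 hB
  rw [tendsto_iff_norm_sub_tendsto_zero]
  refine squeeze_zero (fun _ => norm_nonneg _) (fun k => ?_) hlim.inv_tendsto_atTop
  have hid := tail_den_identity hB0 hB1 hB hY k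
  have herr := tail_error_identity hA0 hA1 hA hB0 hB1 hB hY k
  have hP : 0 < ∏ i ∈ Finset.range (k + 1), a i := Finset.prod_pos fun i _ => ha i
  -- Dropping the positive second term of `hid` cancels `Y` from the error, leaving the reciprocal
  -- of the quantity in `hlim`.
  have hle : B (k + 1) * Y (k + 1) ≤ Y 0 := by
    have := mul_pos (mul_pos (ha (k + 1)) (hBpos k)) (hYpos (k + 2))
    linarith
  have h0 := hYpos 0
  have hk := hBpos k
  have hk1 := hBpos (k + 1)
  have hy := hYpos (k + 1)
  have e : A k / B k - a 0 * Y 1 / Y 0 =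
      ((-1) ^ (k + 1) * (∏ i ∈ Finset.range (k + 1), a i) * Y (k + 1)) / (B k * Y 0) := by
    rw [← herr]
    field_simp
  rw [e, Real.norm_eq_abs, abs_div, abs_mul, abs_mul, abs_pow, abs_neg, abs_one, one_pow, one_mul,
    abs_of_pos hP, abs_of_pos hy, abs_of_pos (mul_pos hk h0), Pi.inv_apply, inv_div,
    div_le_div_iff₀ (by positivity) (by positivity)]
  calc (∏ i ∈ Finset.range (k + 1), a i) * Y (k + 1) * (B k * B (k + 1))
      = (∏ i ∈ Finset.range (k + 1), a i) * B k * (B (k + 1) * Y (k + 1)) := by ring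
    _ ≤ (∏ i ∈ Finset.range (k + 1), a i) * B k * Y 0 := by gcongr
    _ = _ := by ring

theorem den_growth_step (ha : ∀ k, 0 < a k)
    (hB : ∀ k, B (k + 2) = b (k + 1) * B (k + 1) + a (k + 1) * B k) (k : ℕ) :
    B (k + 1) * B (k + 2) / ∏ i ∈ Finset.range (k + 2), a i =
      B k * B (k + 1) / (∏ i ∈ Finset.range (k + 1), a i) +
        b (k + 1) * B (k + 1) ^ 2 / ∏ i ∈ Finset.range (k + 2), a i := by
  have hP : 0 < ∏ i ∈ Finset.range (k + 1), a i := Finset.prod_pos fun i _ => ha i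
  have := ha (k + 1)
  rw [hB, Finset.prod_range_succ _ (k + 1)]
  field_simp
  ring

/-- If the partial numerators come in equal pairs, the odd partial denominators are at least `1`
and the even ones at least `c > 0`, then the products of consecutive denominators outgrow the
products of the partial numerators. -/
theorem tendsto_den_growth {c : ℝ} (hc : 0 < c) (ha : ∀ k, 0 < a k)
    (hpair : ∀ n, a (2 * n + 1) = a (2 * n)) (hodd : ∀ n, 1 ≤ b (2 * n))
    (heven : ∀ n, c ≤ b (2 * n + 1)) (hB0 : B 0 = 1) (hB1 : B 1 = b 0)
    (hB : ∀ k, B (k + 2) = b (k + 1) * B (k + 1) + a (k + 1) * B k) :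
    Tendsto (fun k => B k * B (k + 1) / ∏ i ∈ Finset.range (k + 1), a i) atTop atTop := by
  have hb : ∀ k, 0 < b k := fun k => by
    rcases Nat.even_or_odd' k with ⟨n, rfl | rfl⟩
    · exact one_pos.trans_le (hodd n)
    · exact hc.trans_le (heven n)
  have hBpos := den_pos ha hb hB0 hB1 hB
  have hP : ∀ k, 0 < ∏ i ∈ Finset.range k, a i := fun k => Finset.prod_pos fun i _ => ha i
  have hsq : ∀ n, ∏ i ∈ Finset.range (2 * n), a i = (∏ j ∈ Finset.range n, a (2 * j)) ^ 2 := by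
    intro n
    induction n with
    | zero => simp
    | succ n ih =>
      rw [show 2 * (n + 1) = 2 * n + 1 + 1 by ring, Finset.prod_range_succ, Finset.prod_range_succ,
        Finset.prod_range_succ, ih, hpair]
      ring
  -- Keep only the term `a (2 * n + 2) * B (2 * n + 1)` of the recurrence; the factor `a 0` supplies
  -- the one numerator these steps miss.
  have hlow : ∀ n, ∏ j ∈ Finset.range (n + 1), a (2 * j) ≤ a 0 * B (2 * n + 1) := by
    intro n
    induction n with
    | zero =>
      rw [mul_zero, zero_add, hB1]
      simpa using le_mul_of_one_le_right (ha 0).le (hodd 0)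
    | succ n ih =>
      have h1 := hB (2 * n + 1)
      have h2 := mul_pos (hb (2 * n + 2)) (hBpos (2 * n + 2))
      rw [Finset.prod_range_succ, show 2 * (n + 1) + 1 = 2 * n + 1 + 2 by ring, h1,
        show 2 * n + 1 + 1 = 2 * (n + 1) by ring]
      rw [show 2 * n + 2 = 2 * (n + 1) by ring] at h2
      have h3 := mul_le_mul_of_nonneg_right ih (ha (2 * (n + 1))).le
      have h4 := mul_pos (ha 0) h2
      linarith
  have hmono : Monotone fun k => B k * B (k + 1) / ∏ i ∈ Finset.range (k + 1), a i := by
    refine monotone_nat_of_le_succ fun k => ?_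
    rw [den_growth_step ha hB k]
    have h1 := hP (k + 2)
    have h2 := hb (k + 1)
    have : 0 ≤ b (k + 1) * B (k + 1) ^ 2 / ∏ i ∈ Finset.range (k + 2), a i := by positivity
    linarith
  -- By pairing, the product of numerators is a square bounded through `hlow`, so each two steps add
  -- at least `c / a 0 ^ 2`.
  have hinc : ∀ n : ℕ, n * (c / a 0 ^ 2) ≤
      B (2 * n) * B (2 * n + 1) / ∏ i ∈ Finset.range (2 * n + 1), a i := by
    intro n
    induction n with
    | zero =>
      have := hP 1
      have := hBpos 0
      have := hBpos 1
      simp only [Nat.cast_zero, zero_mul, mul_zero, zero_add]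
      positivity
    | succ n ih =>
      have h1 := hmono (Nat.le_succ (2 * n + 1))
      have h2 := den_growth_step ha hB (2 * n)
      have h3 : c / a 0 ^ 2 ≤
          b (2 * n + 1) * B (2 * n + 1) ^ 2 / ∏ i ∈ Finset.range (2 * n + 2), a i := by
        have hP2 := hP (2 * n + 2)
        have := ha 0
        rw [div_le_div_iff₀ (by positivity) hP2]
        have h4 : ∏ i ∈ Finset.range (2 * n + 2), a i ≤ (a 0 * B (2 * n + 1)) ^ 2 := by
          rw [show 2 * n + 2 = 2 * (n + 1) by ring, hsq]
          exact pow_le_pow_left₀ (Finset.prod_nonneg fun i _ => (ha _).le) (hlow n) 2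
        calc c * ∏ i ∈ Finset.range (2 * n + 2), a i
            ≤ b (2 * n + 1) * (a 0 * B (2 * n + 1)) ^ 2 :=
              mul_le_mul (heven n) h4 hP2.le (hb _).le
          _ = _ := by ring
      push_cast
      simp only [Nat.succ_eq_add_one] at h1
      rw [show 2 * (n + 1) = 2 * n + 1 + 1 by ring]
      linarith
  have hcpos : 0 < c / a 0 ^ 2 := div_pos hc (pow_pos (ha 0) 2)
  refine tendsto_atTop_atTop_of_monotone hmono fun M => ?_
  obtain ⟨n, hn⟩ := exists_nat_ge (M / (c / a 0 ^ 2))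
  exact ⟨2 * n, ((div_le_iff₀ hcpos).1 hn).trans (hinc n)⟩

end Recurrence

theorem GenContFract.hasValue_of_pos_tail {g : GenContFract ℝ} {a b Y : ℕ → ℝ} {c : ℝ}
    (hh : g.h = 0) (hs : ∀ k, g.s.get? k = some ⟨a k, b k⟩) (hc : 0 < c) (ha : ∀ k, 0 < a k)
    (hpair : ∀ n, a (2 * n + 1) = a (2 * n)) (hodd : ∀ n, 1 ≤ b (2 * n))
    (heven : ∀ n, c ≤ b (2 * n + 1))
    (hY : ∀ k, Y k = b k * Y (k + 1) + a (k + 1) * Y (k + 2)) (hYpos : ∀ k, 0 < Y k) :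
    ContFractHasValue g (a 0 * Y 1 / Y 0) := by
  have hb : ∀ k, 0 < b k := fun k => by
    rcases Nat.even_or_odd' k with ⟨n, rfl | rfl⟩
    · exact one_pos.trans_le (hodd n)
    · exact hc.trans_le (heven n)
  have hA0 : g.nums 0 = 0 := by rw [GenContFract.zeroth_num_eq_h, hh]
  have hA1 : g.nums 1 = a 0 := by rw [GenContFract.first_num_eq (hs 0), hh]; simp
  have hA : ∀ k, g.nums (k + 2) = b (k + 1) * g.nums (k + 1) + a (k + 1) * g.nums k :=
    fun k => GenContFract.nums_recurrence (hs (k + 1)) rfl rfl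
  have hB0 : g.dens 0 = 1 := GenContFract.zeroth_den_eq_one
  have hB1 : g.dens 1 = b 0 := GenContFract.first_den_eq (hs 0)
  have hB : ∀ k, g.dens (k + 2) = b (k + 1) * g.dens (k + 1) + a (k + 1) * g.dens k :=
    fun k => GenContFract.dens_recurrence (hs (k + 1)) rfl rfl
  exact ⟨Eventually.of_forall fun k => (den_pos ha hb hB0 hB1 hB k).ne',
    tendsto_div_of_pos_tail ha hb hA0 hA1 hA hB0 hB1 hB hY hYpos
      (tendsto_den_growth hc ha hpair hodd heven hB0 hB1 hB)⟩

/-! ### Tails built from the Laplace transforms, and the theorem -/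

/-- A positive solution of the recurrence for the tails of the continued fraction. -/
noncomputable def laplaceTail (p r : ℝ) (k : ℕ) : ℝ :=
  (if Even k then laplaceSechMoment p (k / 2)
    else laplaceSechMoment p (k / 2) - laplaceSechMoment p (k / 2 + 1)) /
    (4 ^ (k / 2) * ((k / 2).factorial : ℝ) ^ 2 * r ^ (2 * (k / 2)))

theorem laplaceTail_even (p r : ℝ) (n : ℕ) : laplaceTail p r (2 * n) =
    laplaceSechMoment p n / (4 ^ n * (n.factorial : ℝ) ^ 2 * r ^ (2 * n)) := by
  simp [laplaceTail]

theorem laplaceTail_odd (p r : ℝ) (n : ℕ) : laplaceTail p r (2 * n + 1) =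
    (laplaceSechMoment p n - laplaceSechMoment p (n + 1)) /
      (4 ^ n * (n.factorial : ℝ) ^ 2 * r ^ (2 * n)) := by
  have h : (2 * n + 1) / 2 = n := by omega
  simp [laplaceTail, h]

theorem laplaceTail_pos {p r : ℝ} (hp : 0 < p) (hr : 0 < r) (k : ℕ) : 0 < laplaceTail p r k := by
  have hf : ∀ n : ℕ, (0 : ℝ) < n.factorial := fun n => by exact_mod_cast n.factorial_pos
  rcases Nat.even_or_odd' k with ⟨n, rfl | rfl⟩
  · rw [laplaceTail_even]
    have := laplaceSechMoment_pos hp n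
    have := hf n
    positivity
  · rw [laplaceTail_odd]
    have := sub_pos.2 (laplaceSechMoment_succ_lt hp n)
    have := hf n
    positivity

/-- The normalizing factor is the product of `4 j² r²` over `1 ≤ j ≤ n`; with it removed, only a
telescoping identity remains. -/
theorem laplaceTail_even_eq (p : ℝ) {r : ℝ} (hr : 0 < r) (n : ℕ) :
    laplaceTail p r (2 * n) =
      laplaceTail p r (2 * n + 1) + 4 * (n + 1) ^ 2 * r ^ 2 * laplaceTail p r (2 * (n + 1)) := by
  have hf : (n.factorial : ℝ) ≠ 0 := by exact_mod_cast n.factorial_ne_zero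
  have hn : (n + 1 : ℝ) ≠ 0 := by positivity
  rw [laplaceTail_odd, laplaceTail_even, laplaceTail_even, Nat.factorial_succ, mul_add 2 n 1,
    pow_add r, pow_succ 4 n]
  push_cast
  field_simp
  ring

theorem laplaceTail_odd_eq {p r : ℝ} (hp : 0 < p) (hr : 0 < r) (n : ℕ) :
    laplaceTail p r (2 * n + 1) = (p ^ 2 - 1) * r ^ 2 * laplaceTail p r (2 * (n + 1)) +
      4 * (n + 2) ^ 2 * r ^ 2 * laplaceTail p r (2 * (n + 1) + 1) := by
  have hf : (n.factorial : ℝ) ≠ 0 := by exact_mod_cast n.factorial_ne_zero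
  have hn : (n + 1 : ℝ) ≠ 0 := by positivity
  have h := laplaceSechMoment_succ hp n
  rw [laplaceTail_odd, laplaceTail_even, laplaceTail_odd, Nat.factorial_succ, mul_add 2 n 1,
    pow_add r, pow_succ 4 n]
  push_cast
  field_simp
  linear_combination -h

theorem theorem11 (φ : ℝ → ℝ → ℝ) (s r : ℝ) (hr : 0 < r) (hφ : r < φ s r) :
    ∃ T : ℝ,
      ContFractHasValue
        (twoStepContFract 0
          (fun n => 4 * (n : ℝ) ^ 2 * r ^ 2) (fun _ => 1)
          (fun n => 4 * (n : ℝ) ^ 2 * r ^ 2) (fun _ => φ s r ^ 2 - r ^ 2)) T ∧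
      φ s r ^ 2 - r ^ 2 + T ≠ 0 ∧
      IntegrableOn (fun x : ℝ => x * Real.exp (-x * (φ s r / r)) / Real.cosh x) (Ioi 0) ∧
      1 / (φ s r ^ 2 - r ^ 2 + T) =
        1 / r ^ 2 * ∫ x in Ioi (0 : ℝ), x * Real.exp (-x * (φ s r / r)) / Real.cosh x := by
  obtain ⟨p, hpdef⟩ : ∃ p, p = φ s r / r := ⟨_, rfl⟩
  have hφp : φ s r = p * r := by rw [hpdef]; field_simp
  have hp1 : 1 < p := by rw [hpdef, one_lt_div hr]; exact hφ
  have hp : 0 < p := one_pos.trans hp1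
  have hC : φ s r ^ 2 - r ^ 2 = (p ^ 2 - 1) * r ^ 2 := by rw [hφp]; ring
  have hCpos : 0 < (p ^ 2 - 1) * r ^ 2 := mul_pos (by nlinarith) (by positivity)
  rw [hC, ← hpdef]
  have hfun : (fun x : ℝ => x * Real.exp (-x * p) / Real.cosh x) =
      fun x => Real.exp (-p * x) * sechMoment 0 x := by
    ext x
    rw [sechMoment, sinhMoment_zero_apply, show -x * p = -p * x by ring]
    simp
    ring
  rw [hfun]
  have hY0 : laplaceTail p r 0 = laplaceSechMoment p 0 := by
    simpa using laplaceTail_even p r 0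
  have hY1 : laplaceTail p r 1 = laplaceSechMoment p 0 - laplaceSechMoment p 1 := by
    simpa using laplaceTail_odd p r 0
  have hval := GenContFract.hasValue_of_pos_tail
    (g := twoStepContFract 0 (fun n => 4 * (n : ℝ) ^ 2 * r ^ 2) (fun _ => 1)
      (fun n => 4 * (n : ℝ) ^ 2 * r ^ 2) (fun _ => (p ^ 2 - 1) * r ^ 2))
    (a := fun k => 4 * ((k / 2 + 1 : ℕ) : ℝ) ^ 2 * r ^ 2)
    (b := fun k => if Even k then 1 else (p ^ 2 - 1) * r ^ 2) (Y := laplaceTail p r)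
    rfl (fun k => ?_) hCpos (fun k => by positivity) (fun n => ?_) (fun n => by simp)
    (fun n => by simp) (fun k => ?_) (laplaceTail_pos hp hr)
  · have hu := laplaceSechMoment_pos hp 0
    have hz := laplaceSechMoment_zero hp
    -- The inhomogeneous equation `hz`, divided by `u 0` and scaled by `r²`; `0 / 2 + 1` is the
    -- index form of the first numerator in `hval`.
    have hsum : (p ^ 2 - 1) * r ^ 2 + 4 * ((0 / 2 + 1 : ℕ) : ℝ) ^ 2 * r ^ 2 * laplaceTail p r 1 /
        laplaceTail p r 0 = r ^ 2 / laplaceSechMoment p 0 := by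
      rw [hY0, hY1]
      field_simp
      push_cast
      linear_combination hz
    refine ⟨_, hval, ?_, integrableOn_exp_neg_mul_sechMoment hp 0, ?_⟩
    · rw [hsum]
      positivity
    · rw [hsum, ← laplaceSechMoment]
      field_simp
  · change some _ = some _
    by_cases hk : Even k <;> simp [hk, Stream'.get]
  · rw [show (2 * n + 1) / 2 = 2 * n / 2 by omega]
  · rcases Nat.even_or_odd' k with ⟨n, rfl | rfl⟩
    · simp only [even_two_mul, if_true, one_mul]
      rw [show (2 * n + 1) / 2 = n by omega]
      exact_mod_cast laplaceTail_even_eq p hr n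
    · have h := laplaceTail_odd_eq hp hr n
      simp only [Nat.not_even_two_mul_add_one, if_false]
      rw [show (2 * n + 1 + 1) / 2 = n + 1 by omega]
      rw [show 2 * n + 1 + 2 = 2 * (n + 1) + 1 by ring, show 2 * n + 1 + 1 = 2 * (n + 1) by ring]
      have hn : ((n + 1 + 1 : ℕ) : ℝ) = n + 2 := by push_cast; ring
      rw [hn]
      exact h
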